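/- Let $\mathbb T^2=(\mathbb R/2\pi\mathbb Z)^2$. Given any viscosity and resistivity $\nu,\eta>0$, any $T>0$ and any $K\in\mathbb R$, there exist a smooth, zero-average, divergence-free vector field $b_0$ on $\mathbb T^2$ and two smooth (time-dependent) vector fields $f_1,f_2$ on $[0,\infty)\times\mathbb T^2$, with zero spatial average at every time, such that: (i) the forced MHD system $$\begin{cases}\partial_t u+(u\cdot\nabla)u+\nabla P=\nu\Delta u+(b\cdot\nabla)b+f_1,\\ \partial_t b+(u\cdot\nabla)b=(b\cdot\nabla)u+\eta\Delta b+f_2,\\ \operatorname{div}u=\operatorname{div}b=0,\\ u(0,\cdot)=0,\quad b(0,\cdot)=b_0\end{cases}$$ has a unique global smooth solution $(u,b)$ on $[0,\infty)\times\mathbb T^2$ (with some smooth pressure $P$ on $[0,\infty)\times\mathbb T^2$), and $u(t,\cdot)$, $b(t,\cdot)$ have zero average for all $t\ge 0$; (ii) the magnetic lines at times $t=0$ and $t=T$ are not topologically equivalent: there is no homeomorphism of $\mathbb T^2$ that maps every integral line of $b(0,\cdot)$ onto an integral line of $b(T,\cdot)$ (an integral line of a vector field $v$ is the image of a maximal solution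 of $\dot\gamma=v(\gamma)$); (iii) for some positive integers $n,m,k,l$ with $n^2+m^2>K(k^2+l^2)$, and for all $t\ge0$, $$u(t,\cdot)=0,\qquad b(t,\cdot)=e^{-\eta(n^2+m^2)t}\,T_{nm}+\frac{1-e^{-\eta(k^2+l^2)t}}{\eta(k^2+l^2)}\,T_{kl},$$ where $T_{nm}(x,y)=(m\sin nx\sin my,\;n\cos nx\cos my)$ is the Taylor field with $-\Delta T_{nm}=(n^2+m^2)T_{nm}$. -/

import Mathlib

namespace MHD

open scoped ContDiff

noncomputable section

/-- The flat two-dimensional torus `(ℝ / 2πℤ)²`. -/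
abbrev Torus : Type := Fin 2 → Real.Angle

/-- Vectors of `ℝ²`, written by their components. -/
abbrev Vec : Type := Fin 2 → ℝ

/-- The covering map `ℝ² → (ℝ / 2πℤ)²`. -/
def proj (x : Vec) : Torus := fun i => (x i : Real.Angle)

/-- The partial derivative of a function on the torus in the `i`-th coordinate direction. -/
def pd (i : Fin 2) (g : Torus → ℝ) (q : Torus) : ℝ :=
  deriv (fun s : ℝ => g (q + Pi.single i (s : Real.Angle))) 0

/-- The Laplacian of a function on the torus. -/
def laplacian (g : Torus → ℝ) (q : Torus) : ℝ := ∑ j, pd j (pd j g) q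

/-- The divergence of a vector field on the torus. -/
def divergence (v : Torus → Vec) (q : Torus) : ℝ := ∑ j, pd j (fun p => v p j) q

/-- The `i`-th component of `(v · ∇) w`. -/
def advect (v w : Torus → Vec) (q : Torus) (i : Fin 2) : ℝ :=
  ∑ j, v q j * pd j (fun p => w p i) q

/-- A vector field on the torus is smooth if its periodic lift to `ℝ²` is `C^∞`. -/
def SmoothField (v : Torus → Vec) : Prop := ContDiff ℝ ∞ (fun x : Vec => v (proj x))

/-- Smoothness on `[0, ∞) × 𝕋²` (up to the initial time, jointly in time and space) of a
time-dependent function on the torus; its values at negative times play no role. -/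
def SmoothInTime {E : Type} [NormedAddCommGroup E] [NormedSpace ℝ E]
    (v : ℝ → Torus → E) : Prop :=
  ContDiffOn ℝ ∞ (fun p : ℝ × Vec => v p.1 (proj p.2)) (Set.Ici 0 ×ˢ Set.univ)

/-- The field has zero average over the torus. -/
def ZeroAverage (v : Torus → Vec) : Prop :=
  ∀ i, ∫ x in (0 : ℝ)..(2 * Real.pi), ∫ y in (0 : ℝ)..(2 * Real.pi), v (proj ![x, y]) i = 0

/-- The field is divergence-free. -/
def DivergenceFree (v : Torus → Vec) : Prop := ∀ q, divergence v q = 0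

/-- `(u, b)` is a smooth solution, global in time on `[0, ∞) × 𝕋²`, of the MHD system with
viscosity `ν`, resistivity `η`, forces `f₁` and `f₂`, and initial datum `(u₀, b₀)`, for some
smooth pressure `P` on the torus:
`∂ₜu + (u·∇)u + ∇P = νΔu + (b·∇)b + f₁`, `∂ₜb + (u·∇)b = (b·∇)u + ηΔb + f₂`,
`div u = div b = 0`. At `t = 0` the time derivative is the right derivative. -/
structure IsGlobalSmoothSolution (ν η : ℝ) (f₁ f₂ : ℝ → Torus → Vec) (u₀ b₀ : Torus → Vec)
    (u b : ℝ → Torus → Vec) : Prop where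
  smooth_u : SmoothInTime u
  smooth_b : SmoothInTime b
  div_u : ∀ t, 0 ≤ t → DivergenceFree (u t)
  div_b : ∀ t, 0 ≤ t → DivergenceFree (b t)
  momentum : ∃ P : ℝ → Torus → ℝ, SmoothInTime P ∧ ∀ t, 0 ≤ t → ∀ q i,
    derivWithin (fun s => u s q i) (Set.Ici 0) t + advect (u t) (u t) q i + pd i (P t) q
      = ν * laplacian (fun p => u t p i) q + advect (b t) (b t) q i + f₁ t q i
  magnetic : ∀ t, 0 ≤ t → ∀ q i,
    derivWithin (fun s => b s q i) (Set.Ici 0) t + advect (u t) (b t) q i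
      = advect (b t) (u t) q i + η * laplacian (fun p => b t p i) q + f₂ t q i
  initial_u : u 0 = u₀
  initial_b : b 0 = b₀

/-- `L` is an integral line of `v`: the image in the torus of an integral curve defined for all
times, described through its lift to `ℝ²`. (Smooth fields on the torus are complete, so these are
exactly the images of the maximal integral curves.) -/
def IsIntegralLine (v : Torus → Vec) (L : Set Torus) : Prop :=
  ∃ X : ℝ → Vec, (∀ s, HasDerivAt X (v (proj (X s))) s) ∧ L = Set.range (fun s => proj (X s))

/-- Some homeomorphism of the torus maps integral lines of `v` onto integral lines of `w`.
(For smooth fields the integral lines partition the torus, so all integral lines of `w` are then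
obtained and the relation is symmetric.) -/
def TopologicallyEquivalent (v w : Torus → Vec) : Prop :=
  ∃ h : Torus ≃ₜ Torus, ∀ L, IsIntegralLine v L → IsIntegralLine w (h '' L)

/-- The Taylor field `T_{nm} = (m sin nx sin my, n cos nx cos my)`, an eigenfunction of `-Δ` with
eigenvalue `n² + m²`. -/
def taylor (n m : ℕ) (q : Torus) : Vec :=
  ![m * (Real.Angle.sin (n • q 0) * Real.Angle.sin (m • q 1)),
    n * (Real.Angle.cos (n • q 0) * Real.Angle.cos (m • q 1))]

end

end MHD

namespace MHD

open Set MeasureTheory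
open scoped ContDiff

/-! ### Calculus on the torus -/

/-! The solution is explicit. With `u = 0` and constant pressure, the force `f₁ = -(b·∇)b` balances
the Lorentz term, and the magnetic equation becomes a heat equation with steady source `f₂ =
T_{kl}`. Taylor fields are Laplace eigenfunctions, so Duhamel's formula from the datum `T_{nm}`
gives `reconnectingField`. Zero averages hold because every field concerned is a divergence.

The topological obstruction is the number of stationary points. These are exactly the one-point
integral lines, so an equivalence injects the zeros of `b(0)` into those of `b(T)`
(`TopologicallyEquivalent.encard_zeros_le`). Take `m = k = l = 1` and `n` odd and large. Then
`T_{n1}` has at least `2n` zeros, while `b(T) = a T_{n1} + c T_{11}` with `a` exponentially small in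
`n²` and `c` independent of `n`. Once `a n² < c`, all zeros of `b(T)` are zeros of `T_{11}`, at most
16 points (`zeros_combination_subset`), so `n ≥ 9` suffices.

Uniqueness is an energy estimate for the difference of two solutions
(`exists_flux_deriv_energyDensity_le`), followed by Grönwall. Only the explicit solution needs a
gradient bound; nothing is assumed of the competitor beyond smoothness. -/

/-- A scalar function on the torus is smooth if its periodic lift is. -/
def Smooth (g : Torus → ℝ) : Prop := ContDiff ℝ ∞ (fun x : Vec => g (proj x))

/-- Joint smoothness, over the times in `I`, of a time-dependent function on the torus. -/
def SmoothOver {E : Type} [NormedAddCommGroup E] [NormedSpace ℝ E] (I : Set ℝ)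
    (v : ℝ → Torus → E) : Prop :=
  ContDiffOn ℝ ∞ (fun p : ℝ × Vec => v p.1 (proj p.2)) (I ×ˢ univ)

theorem proj_add_single (x : Vec) (j : Fin 2) (s : ℝ) :
    proj x + Pi.single j (s : Real.Angle) = proj (x + s • Pi.single j 1) := by
  ext i
  by_cases h : i = j
  · subst h; simp [proj]
  · simp [proj, h]

/-- The closed cube is a compact set covering the torus; bounds and integrals of functions on the
torus are reduced to it. -/
theorem exists_proj_eq (q : Torus) :
    ∃ x ∈ Icc (0 : Vec) (fun _ => 2 * Real.pi), proj x = q := by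
  have h : ∀ i, ∃ r ∈ Icc (0 : ℝ) (2 * Real.pi), (r : Real.Angle) = q i := fun i => by
    have hm := toIcoMod_mem_Ico Real.two_pi_pos 0 (q i).toReal
    rw [zero_add] at hm
    exact ⟨_, Ico_subset_Icc_self hm, by rw [Real.Angle.coe_toIcoMod, Real.Angle.coe_toReal]⟩
  choose r hr hq using h
  exact ⟨r, ⟨fun i => (hr i).1, fun i => (hr i).2⟩, funext hq⟩

theorem proj_surjective : Function.Surjective proj := fun q =>
  let ⟨x, _, hx⟩ := exists_proj_eq q
  ⟨x, hx⟩

theorem pd_proj {g : Torus → ℝ} (x : Vec) (j : Fin 2) :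
    pd j g (proj x) = lineDeriv ℝ (fun y : Vec => g (proj y)) x (Pi.single j 1) := by
  simp only [pd, lineDeriv, proj_add_single]

namespace Smooth

variable {f g : Torus → ℝ}

theorem pd_proj_eq_fderiv (hg : Smooth g) (x : Vec) (j : Fin 2) :
    pd j g (proj x) = fderiv ℝ (fun y : Vec => g (proj y)) x (Pi.single j 1) := by
  rw [pd_proj]
  exact (hg.contDiffAt.differentiableAt (by simp)).lineDeriv_eq_fderiv

theorem hasDerivAt (hg : Smooth g) (j : Fin 2) (q : Torus) :
    HasDerivAt (fun s : ℝ => g (q + Pi.single j (s : Real.Angle))) (pd j g q) 0 := by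
  obtain ⟨x, rfl⟩ := proj_surjective q
  simp only [proj_add_single, hg.pd_proj_eq_fderiv]
  exact ((hg.contDiffAt.differentiableAt (by simp)).hasFDerivAt.hasLineDerivAt _)

theorem pd (hg : Smooth g) (j : Fin 2) : Smooth (MHD.pd j g) := by
  unfold Smooth
  simp only [hg.pd_proj_eq_fderiv]
  exact (ContDiff.fderiv_right (m := ∞) hg (by simp)).clm_apply contDiff_const

theorem add (hf : Smooth f) (hg : Smooth g) : Smooth (fun q => f q + g q) := ContDiff.add hf hg

theorem mul (hf : Smooth f) (hg : Smooth g) : Smooth (fun q => f q * g q) := ContDiff.mul hf hg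

theorem const_mul (c : ℝ) (hf : Smooth f) : Smooth (fun q => c * f q) :=
  ContDiff.mul contDiff_const hf

theorem sum {ι : Type*} {s : Finset ι} {f : ι → Torus → ℝ} (hf : ∀ i ∈ s, Smooth (f i)) :
    Smooth (fun q => ∑ i ∈ s, f i q) := ContDiff.sum hf

theorem continuous_proj (hf : Smooth f) : Continuous (fun x : Vec => f (proj x)) :=
  ContDiff.continuous hf

theorem integrableOn (hf : Smooth f) :
    IntegrableOn (fun x => f (proj x)) (Icc (0 : Vec) (fun _ => 2 * Real.pi)) :=
  hf.continuous_proj.continuousOn.integrableOn_compact isCompact_Icc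

theorem exists_abs_le (hf : Smooth f) : ∃ C, ∀ q, |f q| ≤ C := by
  obtain ⟨C, hC⟩ := (isCompact_Icc (a := (0 : Vec))
    (b := fun _ => 2 * Real.pi)).exists_bound_of_continuousOn hf.continuous_proj.continuousOn
  refine ⟨C, fun q => ?_⟩
  obtain ⟨x, hx, rfl⟩ := exists_proj_eq q
  exact hC x hx

theorem pd_add (hf : Smooth f) (hg : Smooth g) (j : Fin 2) (q : Torus) :
    MHD.pd j (fun p => f p + g p) q = MHD.pd j f q + MHD.pd j g q :=
  ((hf.hasDerivAt j q).add (hg.hasDerivAt j q)).deriv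

theorem pd_mul (hf : Smooth f) (hg : Smooth g) (j : Fin 2) (q : Torus) :
    MHD.pd j (fun p => f p * g p) q = MHD.pd j f q * g q + f q * MHD.pd j g q := by
  simpa using! ((hf.hasDerivAt j q).mul (hg.hasDerivAt j q)).deriv

end Smooth

theorem pd_const_mul (c : ℝ) (f : Torus → ℝ) (j : Fin 2) (q : Torus) :
    pd j (fun p => c * f p) q = c * pd j f q := by
  simp [pd]

/-- The divergence theorem on the torus. -/
theorem setIntegral_sum_pd {F : Fin 2 → Torus → ℝ} (hF : ∀ j, Smooth (F j)) :
    ∫ x in Icc (0 : Vec) (fun _ => 2 * Real.pi), ∑ j, pd j (F j) (proj x) = 0 := by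
  have hd : ∀ j, Differentiable ℝ (fun x : Vec => F j (proj x)) := fun j =>
    ContDiff.differentiable (hF j) (by simp)
  have key := integral_divergence_of_hasFDerivAt_off_countable' (E := ℝ) (n := 1)
    (0 : Vec) (fun _ => 2 * Real.pi) (fun _ => Real.two_pi_pos.le)
    (fun j x => F j (proj x)) (fun j x => fderiv ℝ (fun y : Vec => F j (proj y)) x) ∅
    countable_empty (fun j => (hF j).continuous_proj.continuousOn)
    (fun x _ j => (hd j x).hasFDerivAt) (by
      simp only [← (hF _).pd_proj_eq_fderiv]
      exact (Smooth.sum (fun j _ => (hF j).pd j)).integrableOn)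
  simp only [← (hF _).pd_proj_eq_fderiv] at key
  rw [key]
  -- Opposite faces of the cube project to the same points of the torus, so their fluxes cancel.
  refine Finset.sum_eq_zero fun j _ => sub_eq_zero.2 ?_
  congr 1 with x
  congr 1
  ext i
  refine Fin.succAboveCases j ?_ (fun k => ?_) i
  · simp [proj]
  · simp [proj]

theorem setIntegral_Icc_eq_intervalIntegral {f : Vec → ℝ} (hf : Continuous f) :
    ∫ x in Icc (0 : Vec) (fun _ => 2 * Real.pi), f x =
      ∫ x in (0 : ℝ)..(2 * Real.pi), ∫ y in (0 : ℝ)..(2 * Real.pi), f ![x, y] := by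
  have e := (volume_preserving_finTwoArrow ℝ).symm
  have hpre : (MeasurableEquiv.finTwoArrow (α := ℝ)).symm ⁻¹' Icc (0 : Vec) (fun _ => 2 * Real.pi)
      = Icc (0 : ℝ) (2 * Real.pi) ×ˢ Icc (0 : ℝ) (2 * Real.pi) := by
    ext p
    simp [MeasurableEquiv.finTwoArrow, Pi.le_def, Fin.forall_fin_two, Prod.le_def]
  rw [← e.setIntegral_preimage_emb (MeasurableEquiv.measurableEmbedding _), hpre,
    Measure.volume_eq_prod, setIntegral_prod]
  · simp only [intervalIntegral.integral_of_le Real.two_pi_pos.le, ← integral_Icc_eq_integral_Ioc]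
    rfl
  · refine ContinuousOn.integrableOn_compact (isCompact_Icc.prod isCompact_Icc) ?_
    refine (hf.comp (?_ : Continuous fun p : ℝ × ℝ => (![p.1, p.2] : Vec))).continuousOn
    fun_prop

/-- A field whose components are divergences has zero average. -/
theorem zeroAverage_of_eq_divergence {v : Torus → Vec} {F : Fin 2 → Fin 2 → Torus → ℝ}
    (hF : ∀ i j, Smooth (F i j)) (hv : ∀ q i, v q i = ∑ j, pd j (F i j) q) : ZeroAverage v := by
  intro i
  have hs : Smooth (fun q => ∑ j, pd j (F i j) q) := Smooth.sum fun j _ => (hF i j).pd j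
  simp only [hv]
  rw [← setIntegral_Icc_eq_intervalIntegral (f := fun x => ∑ j, pd j (F i j) (proj x))
    hs.continuous_proj]
  exact setIntegral_sum_pd (hF i)

/-! ### Functions of time and space: derivatives and integrals -/

namespace SmoothOver

variable {I : Set ℝ} {f g : ℝ → Torus → ℝ}

theorem mono {E : Type} [NormedAddCommGroup E] [NormedSpace ℝ E] {J : Set ℝ} {v : ℝ → Torus → E}
    (hv : SmoothOver J v) (h : I ⊆ J) : SmoothOver I v :=
  ContDiffOn.mono hv (prod_mono h Subset.rfl)

theorem apply {v : ℝ → Torus → Vec} (hv : SmoothOver I v) (i : Fin 2) :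
    SmoothOver I (fun t q => v t q i) :=
  contDiffOn_pi.1 hv i

theorem pi {v : ℝ → Torus → Vec} (hv : ∀ i, SmoothOver I (fun t q => v t q i)) : SmoothOver I v :=
  contDiffOn_pi.2 hv

theorem add (hf : SmoothOver I f) (hg : SmoothOver I g) : SmoothOver I (fun t q => f t q + g t q) :=
  ContDiffOn.add hf hg

theorem sub (hf : SmoothOver I f) (hg : SmoothOver I g) : SmoothOver I (fun t q => f t q - g t q) :=
  ContDiffOn.sub hf hg

theorem neg (hf : SmoothOver I f) : SmoothOver I (fun t q => -f t q) :=
  ContDiffOn.neg hf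

theorem mul (hf : SmoothOver I f) (hg : SmoothOver I g) : SmoothOver I (fun t q => f t q * g t q) :=
  ContDiffOn.mul hf hg

theorem sum {ι : Type*} {s : Finset ι} {f : ι → ℝ → Torus → ℝ}
    (hf : ∀ i ∈ s, SmoothOver I (f i)) : SmoothOver I (fun t q => ∑ i ∈ s, f i t q) :=
  ContDiffOn.sum hf

theorem smooth (hf : SmoothOver I f) {t : ℝ} (ht : t ∈ I) : Smooth (f t) :=
  contDiffOn_univ.1 (ContDiffOn.comp (t := I ×ˢ univ) hf
    (g := fun p : ℝ × Vec => f p.1 (proj p.2)) (f := fun x : Vec => (t, x))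
    (contDiff_prodMk_right t).contDiffOn (fun _ _ => ⟨ht, mem_univ _⟩))

theorem differentiableAt (hI : IsOpen I) (hf : SmoothOver I f) {t : ℝ} (ht : t ∈ I) (x : Vec) :
    DifferentiableAt ℝ (fun p : ℝ × Vec => f p.1 (proj p.2)) (t, x) :=
  (ContDiffOn.contDiffAt hf ((hI.prod isOpen_univ).mem_nhds ⟨ht, mem_univ _⟩)).differentiableAt
    (by simp)

theorem contDiffOn_fderiv_apply (hI : IsOpen I) (hf : SmoothOver I f) (v : ℝ × Vec) :
    ContDiffOn ℝ ∞ (fun p => fderiv ℝ (fun p : ℝ × Vec => f p.1 (proj p.2)) p v) (I ×ˢ univ) :=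
  (ContDiffOn.fderiv_of_isOpen hf (hI.prod isOpen_univ) (by simp)).clm_apply contDiffOn_const

/-- Over an open set of times the spatial derivative is the joint Fréchet derivative in the
direction `(0, e_j)`, which is again smooth. -/
theorem pd (hI : IsOpen I) (hf : SmoothOver I f) (j : Fin 2) :
    SmoothOver I (fun t => MHD.pd j (f t)) := by
  refine (hf.contDiffOn_fderiv_apply hI (0, Pi.single j 1)).congr ?_
  rintro ⟨t, x⟩ ⟨ht, -⟩
  have h := (hf.differentiableAt hI ht x).lineDeriv_eq_fderiv (v := (0, Pi.single j 1))
  rw [← h]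
  simp [pd_proj, lineDeriv]

theorem hasDerivAt (hI : IsOpen I) (hf : SmoothOver I f) {t : ℝ} (ht : t ∈ I) (q : Torus) :
    HasDerivAt (fun s => f s q) (deriv (fun s => f s q) t) t := by
  obtain ⟨x, rfl⟩ := proj_surjective q
  exact (DifferentiableAt.comp t (hf.differentiableAt hI ht x)
    (differentiableAt_id.prodMk (differentiableAt_const x))).hasDerivAt

theorem deriv (hI : IsOpen I) (hf : SmoothOver I f) :
    SmoothOver I (fun t q => deriv (fun s => f s q) t) := by
  refine (hf.contDiffOn_fderiv_apply hI (1, 0)).congr ?_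
  rintro ⟨t, x⟩ ⟨ht, -⟩
  have h := ((hf.differentiableAt hI ht x).hasFDerivAt.comp_hasDerivAt t
    ((hasDerivAt_id t).prodMk (hasDerivAt_const t x)))
  exact h.deriv

/-- Differentiation under the integral sign. -/
theorem hasDerivAt_setIntegral (hI : IsOpen I) (hf : SmoothOver I f) {t : ℝ} (ht : t ∈ I) :
    HasDerivAt (fun s => ∫ x in Icc (0 : Vec) (fun _ => 2 * Real.pi), f s (proj x))
      (∫ x in Icc (0 : Vec) (fun _ => 2 * Real.pi), _root_.deriv (fun s => f s (proj x)) t) t := by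
  -- On a compact neighbourhood of `t` times the cube, the time derivative is bounded; that constant
  -- is the dominating function.
  obtain ⟨K, hKt, hKI, hK⟩ := local_compact_nhds (hI.mem_nhds ht)
  have hcont : ∀ g : ℝ → Torus → ℝ, SmoothOver I g → ∀ s ∈ I,
      Continuous fun x : Vec => g s (proj x) := fun g hg s hs => (hg.smooth hs).continuous_proj
  obtain ⟨C, hC⟩ := (hK.prod (isCompact_Icc (a := (0 : Vec))
    (b := fun _ => 2 * Real.pi))).exists_bound_of_continuousOn
    (ContDiffOn.continuousOn ((hf.deriv hI).mono hKI) |>.mono (prod_mono Subset.rfl (subset_univ _)))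
  refine (hasDerivAt_integral_of_dominated_loc_of_deriv_le (bound := fun _ => C) (s := K)
    (F' := fun s x => _root_.deriv (fun r => f r (proj x)) s) hKt ?_ ?_ ?_ ?_ ?_ ?_).2
  · filter_upwards [hKt] with s hs
    exact (hcont f hf s (hKI hs)).aestronglyMeasurable
  · exact (hf.smooth ht).integrableOn
  · exact (hcont _ (hf.deriv hI) t ht).aestronglyMeasurable
  · filter_upwards [ae_restrict_mem measurableSet_Icc] with x hx s hs
    exact hC (s, x) ⟨hs, hx⟩
  · exact integrableOn_const (by exact isCompact_Icc.measure_ne_top)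
  · exact .of_forall fun x s hs => hf.hasDerivAt hI (hKI hs) _

theorem continuousOn_setIntegral (hf : SmoothOver I f) (hI : IsClosed I) :
    ContinuousOn (fun s => ∫ x in Icc (0 : Vec) (fun _ => 2 * Real.pi), f s (proj x)) I := by
  rw [continuousOn_iff_continuous_domRestrict]
  have : LocallyCompactSpace I := hI.isClosedEmbedding_subtypeVal.locallyCompactSpace
  refine continuous_parametric_integral_of_continuous (X := I)
    (f := fun s x => f s (proj x)) ?_ isCompact_Icc
  exact (ContDiffOn.continuousOn hf).comp_continuous
    (f := fun p : I × Vec => ((p.1 : ℝ), p.2)) (by fun_prop) (fun p => ⟨p.1.2, mem_univ _⟩)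

end SmoothOver

/-- The integrand vanishes almost everywhere on the cube, hence everywhere on it by continuity,
since the cube lies in the closure of its interior. -/
theorem Smooth.eq_zero_of_setIntegral_eq_zero {f : Torus → ℝ} (hf : Smooth f) (h0 : ∀ q, 0 ≤ f q)
    (h : ∫ x in Icc (0 : Vec) (fun _ => 2 * Real.pi), f (proj x) = 0) (q : Torus) : f q = 0 := by
  obtain ⟨x, hx, rfl⟩ := exists_proj_eq q
  have hae := (setIntegral_eq_zero_iff_of_nonneg_ae (.of_forall fun x => h0 (proj x))
    hf.integrableOn).1 h
  refine Measure.eqOn_of_ae_eq hae hf.continuous_proj.continuousOn continuousOn_const ?_ hx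
  rw [← Set.pi_univ_Icc, interior_pi_set finite_univ, closure_pi_set]
  refine Set.pi_mono fun i _ => ?_
  rw [interior_Icc, closure_Ioo]
  simp

/-! ### Uniqueness of smooth solutions -/

namespace IsGlobalSmoothSolution

variable {ν η M : ℝ} {f₁ f₂ u b u' b' : ℝ → Torus → Vec} {u₀ b₀ : Torus → Vec}

/-- The energy density of the difference of two solutions. -/
noncomputable def energyDensity (u b u' b' : ℝ → Torus → Vec) (t : ℝ) (q : Torus) : ℝ :=
  1 / 2 * ∑ i, ((u' t q i - u t q i) * (u' t q i - u t q i) +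
    (b' t q i - b t q i) * (b' t q i - b t q i))

theorem energyDensity_nonneg (u b u' b' : ℝ → Torus → Vec) (t : ℝ) (q : Torus) :
    0 ≤ energyDensity u b u' b' t q :=
  mul_nonneg (by norm_num) (Finset.sum_nonneg fun _ _ =>
    add_nonneg (mul_self_nonneg _) (mul_self_nonneg _))

theorem smoothOver_energyDensity {I : Set ℝ} (hu : SmoothOver I u) (hb : SmoothOver I b)
    (hu' : SmoothOver I u') (hb' : SmoothOver I b') :
    SmoothOver I (energyDensity u b u' b') := by
  have hw := fun i => (hu'.apply i).sub (hu.apply i)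
  have hg := fun i => (hb'.apply i).sub (hb.apply i)
  exact ContDiffOn.mul contDiffOn_const
    (SmoothOver.sum fun i _ => ((hw i).mul (hw i)).add ((hg i).mul (hg i)))

/-- For fixed `i, j` the four terms are dominated by `M (|w i| + |g i|)(|w j| + |g j|)`. The double
sum is `M` times the square of a sum of four numbers, and Cauchy–Schwarz costs a factor 4; the 8
compensates the `1 / 2` of the energy. -/
theorem bilinear_remainder_le {M : ℝ} {w g : Fin 2 → ℝ} {Du Db : Fin 2 → Fin 2 → ℝ}
    (hu : ∀ i j, |Du j i| ≤ M) (hb : ∀ i j, |Db j i| ≤ M) :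
    ∑ i, ∑ j, (-(w i * w j * Du j i) + w i * g j * Db j i - g i * w j * Db j i
      + g i * g j * Du j i) ≤ 8 * M * (1 / 2 * ∑ i, (w i * w i + g i * g i)) := by
  have hM : 0 ≤ M := (abs_nonneg _).trans (hu 0 0)
  have hmul : ∀ a c d : ℝ, |d| ≤ M → a * c * d ≤ M * (|a| * |c|) := fun a c d hd => by
    calc a * c * d ≤ |a * c * d| := le_abs_self _
      _ = |d| * (|a| * |c|) := by rw [abs_mul, abs_mul, mul_comm]
      _ ≤ _ := by gcongr
  have hterm : ∀ i j, -(w i * w j * Du j i) + w i * g j * Db j i - g i * w j * Db j i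
      + g i * g j * Du j i ≤ M * ((|w i| + |g i|) * (|w j| + |g j|)) := fun i j => by
    have h1 := hmul (-w i) (w j) _ (hu i j)
    have h2 := hmul (w i) (g j) _ (hb i j)
    have h3 := hmul (-g i) (w j) _ (hb i j)
    have h4 := hmul (g i) (g j) _ (hu i j)
    rw [abs_neg] at h1 h3
    linarith
  have hsq : (∑ i, (|w i| + |g i|)) ^ 2 ≤ 4 * ∑ i, (w i * w i + g i * g i) := by
    simp only [Fin.sum_univ_two, ← sq, ← sq_abs (w _), ← sq_abs (g _)]
    nlinarith [sq_nonneg (|w 0| - |w 1|), sq_nonneg (|w 0| - |g 0|), sq_nonneg (|w 0| - |g 1|),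
      sq_nonneg (|w 1| - |g 0|), sq_nonneg (|w 1| - |g 1|), sq_nonneg (|g 0| - |g 1|)]
  calc _ ≤ ∑ i, ∑ j, M * ((|w i| + |g i|) * (|w j| + |g j|)) :=
        Finset.sum_le_sum fun i _ => Finset.sum_le_sum fun j _ => hterm i j
    _ = M * (∑ i, (|w i| + |g i|)) ^ 2 := by
        rw [sq, Finset.sum_mul_sum]; simp only [Finset.mul_sum]
    _ ≤ M * (4 * ∑ i, (w i * w i + g i * g i)) := by gcongr
    _ = _ := by ring

/-- The energy density grows at a rate bounded by a divergence plus a multiple of itself. -/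
theorem exists_flux_deriv_energyDensity_le (hν : 0 ≤ ν) (hη : 0 ≤ η)
    (h : IsGlobalSmoothSolution ν η f₁ f₂ u₀ b₀ u b)
    (h' : IsGlobalSmoothSolution ν η f₁ f₂ u₀ b₀ u' b')
    (hu : ∀ t, 0 ≤ t → ∀ q i j, |pd j (fun p => u t p i) q| ≤ M)
    (hb : ∀ t, 0 ≤ t → ∀ q i j, |pd j (fun p => b t p i) q| ≤ M) {t : ℝ} (ht : 0 < t) :
    ∃ F : Fin 2 → Torus → ℝ, (∀ j, Smooth (F j)) ∧ ∀ q,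
      deriv (fun s => energyDensity u b u' b' s q) t ≤
        ∑ j, pd j (F j) q + 8 * M * energyDensity u b u' b' t q := by
  obtain ⟨P, hP, hmom⟩ := h.momentum
  obtain ⟨P', hP', hmom'⟩ := h'.momentum
  have htI : t ∈ Ioi (0 : ℝ) := ht
  have sm : ∀ {v : ℝ → Torus → Vec}, SmoothInTime v → ∀ i, SmoothOver (Ioi 0)
      (fun t q => v t q i) := fun hv i =>
    (SmoothOver.mono (J := Ici 0) hv Ioi_subset_Ici_self).apply i
  have su := fun i => (sm h.smooth_u i).smooth htI
  have sb := fun i => (sm h.smooth_b i).smooth htI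
  have su' := fun i => (sm h'.smooth_u i).smooth htI
  have sb' := fun i => (sm h'.smooth_b i).smooth htI
  have sP : Smooth (P t) := (SmoothOver.mono (J := Ici 0) hP Ioi_subset_Ici_self).smooth htI
  have sP' : Smooth (P' t) := (SmoothOver.mono (J := Ici 0) hP' Ioi_subset_Ici_self).smooth htI
  have sub : ∀ {f g : Torus → ℝ}, Smooth f → Smooth g → Smooth (fun q => f q - g q) :=
    fun hf hg => ContDiff.sub hf hg
  have pd_sub : ∀ {f g : Torus → ℝ}, Smooth f → Smooth g → ∀ j q,
      pd j (fun q => f q - g q) q = pd j f q - pd j g q :=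
    fun hf hg j q => ((hf.hasDerivAt j q).sub (hg.hasDerivAt j q)).deriv
  set w : Fin 2 → Torus → ℝ := fun i q => u' t q i - u t q i with hw
  set g : Fin 2 → Torus → ℝ := fun i q => b' t q i - b t q i with hg
  set Q : Torus → ℝ := fun q => P' t q - P t q with hQ
  have sw : ∀ i, Smooth (w i) := fun i => sub (su' i) (su i)
  have sg : ∀ i, Smooth (g i) := fun i => sub (sb' i) (sb i)
  have sQ : Smooth Q := sub sP' sP
  have pw : ∀ i j q, pd j (w i) q = pd j (fun p => u' t p i) q - pd j (fun p => u t p i) q :=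
    fun i j q => pd_sub (su' i) (su i) j q
  have pg : ∀ i j q, pd j (g i) q = pd j (fun p => b' t p i) q - pd j (fun p => b t p i) q :=
    fun i j q => pd_sub (sb' i) (sb i) j q
  have ppw : ∀ i j q, pd j (pd j (w i)) q =
      pd j (pd j (fun p => u' t p i)) q - pd j (pd j (fun p => u t p i)) q := fun i j q => by
    rw [funext (pw i j)]; exact pd_sub ((su' i).pd j) ((su i).pd j) j q
  have ppg : ∀ i j q, pd j (pd j (g i)) q =
      pd j (pd j (fun p => b' t p i)) q - pd j (pd j (fun p => b t p i)) q := fun i j q => by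
    rw [funext (pg i j)]; exact pd_sub ((sb' i).pd j) ((sb i).pd j) j q
  -- Writing `u'·∇u' - u·∇u = u'·∇w + w·∇u`, and likewise for the other products, puts the
  -- competitor only in transport terms. The flux collects transport of the energy by `u'`, pressure
  -- work, viscous and resistive diffusion, and the coupling `b'·∇(w·g)`; the remainder involves
  -- gradients of `u` and `b` alone.
  set F : Fin 2 → Torus → ℝ := fun j q =>
    -(1 / 2) * (u' t q j * ∑ i, (w i q * w i q + g i q * g i q)) + -1 * (w j q * Q q) +
      ∑ i, (ν * (w i q * pd j (w i) q) + η * (g i q * pd j (g i) q) +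
        b' t q j * (w i q * g i q)) with hF
  have hFd : ∀ j q, pd j (F j) q =
      -(1 / 2) * (pd j (fun p => u' t p j) q * (∑ i, (w i q * w i q + g i q * g i q)) +
        u' t q j * ∑ i, (2 * w i q * pd j (w i) q + 2 * g i q * pd j (g i) q)) -
      (pd j (w j) q * Q q + w j q * pd j Q q) +
      ∑ i, (ν * (pd j (w i) q * pd j (w i) q + w i q * pd j (pd j (w i)) q) +
        η * (pd j (g i) q * pd j (g i) q + g i q * pd j (pd j (g i)) q) +
        (pd j (fun p => b' t p j) q * (w i q * g i q) +
          b' t q j * (pd j (w i) q * g i q + w i q * pd j (g i) q))) := fun j q => by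
    have dw := fun i => (sw i).hasDerivAt j q
    have dg := fun i => (sg i).hasDerivAt j q
    have dpw := fun i => ((sw i).pd j).hasDerivAt j q
    have dpg := fun i => ((sg i).pd j).hasDerivAt j q
    have du := (su' j).hasDerivAt j q
    have db := (sb' j).hasDerivAt j q
    have dQ := sQ.hasDerivAt j q
    have d := (((du.mul ((((dw 0).mul (dw 0)).add ((dg 0).mul (dg 0))).add
      (((dw 1).mul (dw 1)).add ((dg 1).mul (dg 1))))).const_mul (-(1 / 2))).add
      (((dw j).mul dQ).const_mul (-1))).add
      ((((((dw 0).mul (dpw 0)).const_mul ν).add (((dg 0).mul (dpg 0)).const_mul η)).add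
        (db.mul ((dw 0).mul (dg 0)))).add
      (((((dw 1).mul (dpw 1)).const_mul ν).add (((dg 1).mul (dpg 1)).const_mul η)).add
        (db.mul ((dw 1).mul (dg 1)))))
    have e := d.deriv
    simp only [Real.Angle.coe_zero, Pi.single_zero, add_zero, Pi.mul_apply, Pi.add_apply] at e
    rw [show pd j (F j) q = _ by
      simp only [hF, Fin.sum_univ_two]; exact e]
    simp only [Fin.sum_univ_two]
    ring
  refine ⟨F, fun j => ?_, fun q => ?_⟩
  · exact ((((su' j).mul (Smooth.sum fun i _ => ((sw i).mul (sw i)).add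
      ((sg i).mul (sg i)))).const_mul _).add (((sw j).mul sQ).const_mul _)).add
      (Smooth.sum fun i _ => ((((sw i).mul ((sw i).pd j)).const_mul ν).add
        (((sg i).mul ((sg i).pd j)).const_mul η)).add ((sb' j).mul ((sw i).mul (sg i))))
  have hR := bilinear_remainder_le (w := fun i => w i q) (g := fun i => g i q)
    (Du := fun j i => pd j (fun p => u t p i) q) (Db := fun j i => pd j (fun p => b t p i) q)
    (fun i j => hu t ht.le q i j) (fun i j => hb t ht.le q i j)
  have dt : ∀ {v : ℝ → Torus → Vec}, SmoothInTime v → ∀ i,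
      HasDerivAt (fun s => v s q i) (derivWithin (fun s => v s q i) (Ici 0) t) t := fun hv i => by
    rw [derivWithin_of_mem_nhds (Ici_mem_nhds ht)]
    exact (sm hv i).hasDerivAt isOpen_Ioi htI q
  have tw := fun i => (dt h'.smooth_u i).sub (dt h.smooth_u i)
  have tg := fun i => (dt h'.smooth_b i).sub (dt h.smooth_b i)
  have te := (((((tw 0).mul (tw 0)).add ((tg 0).mul (tg 0))).add
      (((tw 1).mul (tw 1)).add ((tg 1).mul (tg 1)))).const_mul (1 / 2)).deriv
  simp only [Pi.sub_apply] at te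
  have te' : deriv (fun s => energyDensity u b u' b' s q) t =
      ∑ i, (w i q * (derivWithin (fun s => u' s q i) (Ici 0) t -
          derivWithin (fun s => u s q i) (Ici 0) t) +
        g i q * (derivWithin (fun s => b' s q i) (Ici 0) t -
          derivWithin (fun s => b s q i) (Ici 0) t)) := by
    simp only [energyDensity, Fin.sum_univ_two]
    refine te.trans ?_
    simp only [hw, hg]
    ring
  have hdiss : 0 ≤ ∑ j, ∑ i, (ν * pd j (w i) q ^ 2 + η * pd j (g i) q ^ 2) := by positivity
  have m0 := hmom t ht.le q 0
  have m1 := hmom t ht.le q 1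
  have m0' := hmom' t ht.le q 0
  have m1' := hmom' t ht.le q 1
  have n0 := h.magnetic t ht.le q 0
  have n1 := h.magnetic t ht.le q 1
  have n0' := h'.magnetic t ht.le q 0
  have n1' := h'.magnetic t ht.le q 1
  have du := h.div_u t ht.le q
  have du' := h'.div_u t ht.le q
  have db' := h'.div_b t ht.le q
  have pQ : ∀ i, pd i Q q = pd i (P' t) q - pd i (P t) q := fun i => pd_sub sP' sP i q
  have hE : energyDensity u b u' b' t q = 1 / 2 * ∑ i, (w i q * w i q + g i q * g i q) := rfl
  rw [hE]
  -- The exact energy balance; the inequality follows by discarding the dissipation (`hdiss`) and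
  -- bounding the remainder (`hR`).
  suffices H : deriv (fun s => energyDensity u b u' b' s q) t = ∑ j, pd j (F j) q -
      ∑ j, ∑ i, (ν * pd j (w i) q ^ 2 + η * pd j (g i) q ^ 2) +
      ∑ i, ∑ j, (-(w i q * w j q * pd j (fun p => u t p i) q) +
        w i q * g j q * pd j (fun p => b t p i) q - g i q * w j q * pd j (fun p => b t p i) q
        + g i q * g j q * pd j (fun p => u t p i) q) by linarith
  rw [te']
  simp only [hFd, Fin.sum_univ_two, pQ, ppw, ppg, pw, pg]
  simp only [hw, hg]
  simp only [advect, laplacian, divergence, Fin.sum_univ_two] at m0 m1 m0' m1' n0 n1 n0' n1' du du' db'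
  generalize Q q = Qq
  -- The differences of the equations are tested against `w` and `g`; the divergence constraints
  -- remove the terms where a derivative in the flux falls on `u'`, `b'` or, next to the pressure,
  -- on `w`.
  linear_combination (u' t q 0 - u t q 0) * (m0' - m0) + (u' t q 1 - u t q 1) * (m1' - m1) +
    (b' t q 0 - b t q 0) * (n0' - n0) + (b' t q 1 - b t q 1) * (n1' - n1) +
    (1 / 2 * ((u' t q 0 - u t q 0) ^ 2 + (u' t q 1 - u t q 1) ^ 2 + (b' t q 0 - b t q 0) ^ 2 +
      (b' t q 1 - b t q 1) ^ 2)) * du' + Qq * (du' - du) -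
    ((u' t q 0 - u t q 0) * (b' t q 0 - b t q 0) + (u' t q 1 - u t q 1) * (b' t q 1 - b t q 1)) * db'

/-- Two smooth solutions with the same data coincide as soon as one of them has bounded
gradient. -/
theorem unique (hν : 0 ≤ ν) (hη : 0 ≤ η)
    (h : IsGlobalSmoothSolution ν η f₁ f₂ u₀ b₀ u b)
    (h' : IsGlobalSmoothSolution ν η f₁ f₂ u₀ b₀ u' b')
    (hu : ∀ t, 0 ≤ t → ∀ q i j, |pd j (fun p => u t p i) q| ≤ M)
    (hb : ∀ t, 0 ≤ t → ∀ q i j, |pd j (fun p => b t p i) q| ≤ M) {t : ℝ} (ht : 0 ≤ t) :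
    u' t = u t ∧ b' t = b t := by
  have se : SmoothOver (Ici 0) (energyDensity u b u' b') :=
    smoothOver_energyDensity h.smooth_u h.smooth_b h'.smooth_u h'.smooth_b
  have se' : SmoothOver (Ioi 0) (energyDensity u b u' b') := se.mono Ioi_subset_Ici_self
  set E : ℝ → ℝ := fun s =>
    ∫ x in Icc (0 : Vec) (fun _ => 2 * Real.pi), energyDensity u b u' b' s (proj x) with hE
  have hE0 : ∀ s, 0 ≤ E s := fun s => integral_nonneg fun x => energyDensity_nonneg ..
  have hE' : ∀ s, 0 < s → HasDerivAt E (deriv E s) s ∧ deriv E s ≤ 8 * M * E s := by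
    intro s hs
    have hd := se'.hasDerivAt_setIntegral isOpen_Ioi hs
    refine ⟨hd.differentiableAt.hasDerivAt, ?_⟩
    obtain ⟨F, hF, hle⟩ := exists_flux_deriv_energyDensity_le hν hη h h' hu hb hs
    have sF := Smooth.sum (s := Finset.univ) fun j _ => (hF j).pd j
    have s1 := (se'.smooth hs).const_mul (8 * M)
    rw [hd.deriv]
    calc _ ≤ ∫ x in Icc (0 : Vec) (fun _ => 2 * Real.pi), (∑ j, pd j (F j) (proj x) +
          8 * M * energyDensity u b u' b' s (proj x)) :=
          setIntegral_mono ((se'.deriv isOpen_Ioi).smooth hs).integrableOn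
            (sF.add s1).integrableOn fun x => hle _
      _ = 8 * M * E s := by
          rw [integral_add sF.integrableOn s1.integrableOn, setIntegral_sum_pd hF, zero_add,
            integral_const_mul]
  -- Grönwall with an integrating factor. The differential inequality is needed only for positive
  -- times; continuity of `E` carries the conclusion to time zero.
  have hanti : AntitoneOn (fun s => Real.exp (-(8 * M) * s) * E s) (Ici 0) := by
    have hd : ∀ s ∈ interior (Ici (0 : ℝ)), HasDerivAt (fun s => Real.exp (-(8 * M) * s) * E s)
        (Real.exp (-(8 * M) * s) * (-(8 * M) * 1) * E s + Real.exp (-(8 * M) * s) * deriv E s) s := by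
      intro s hs
      rw [interior_Ici] at hs
      exact (((hasDerivAt_id s).const_mul (-(8 * M))).exp).mul (hE' s hs).1
    refine antitoneOn_of_deriv_nonpos (convex_Ici 0)
      (ContinuousOn.mul (by fun_prop) (se.continuousOn_setIntegral isClosed_Ici))
      (fun s hs => (hd s hs).differentiableAt.differentiableWithinAt) fun s hs => ?_
    rw [(hd s hs).deriv]
    rw [interior_Ici] at hs
    nlinarith [(hE' s hs).2, Real.exp_pos (-(8 * M) * s)]
  have hE00 : E 0 = 0 := by
    simp [hE, energyDensity, h.initial_u, h.initial_b, h'.initial_u, h'.initial_b]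
  have hEt : E t = 0 := by
    have h1 := hanti self_mem_Ici (mem_Ici.2 ht) ht
    simp only [hE00, mul_zero] at h1
    exact le_antisymm (nonpos_of_mul_nonpos_right h1 (Real.exp_pos _)) (hE0 t)
  have hz := (se.smooth (mem_Ici.2 ht)).eq_zero_of_setIntegral_eq_zero
    (energyDensity_nonneg u b u' b' t) hEt
  have hz' : ∀ q i, u' t q i - u t q i = 0 ∧ b' t q i - b t q i = 0 := fun q i => by
    have h2 := hz q
    rw [energyDensity, mul_eq_zero, or_iff_right (by norm_num),
      Finset.sum_eq_zero_iff_of_nonneg fun _ _ =>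
        add_nonneg (mul_self_nonneg _) (mul_self_nonneg _)] at h2
    exact mul_self_add_mul_self_eq_zero.1 (h2 i (Finset.mem_univ i))
  exact ⟨funext fun q => funext fun i => sub_eq_zero.1 (hz' q i).1,
    funext fun q => funext fun i => sub_eq_zero.1 (hz' q i).2⟩

end IsGlobalSmoothSolution

/-! ### Stationary points and topological equivalence -/

theorem isIntegralLine_singleton {v : Torus → Vec} {p : Torus} (hp : v p = 0) :
    IsIntegralLine v {p} := by
  obtain ⟨x, rfl⟩ := proj_surjective p
  exact ⟨fun _ => x, fun s => by rw [hp]; exact hasDerivAt_const s x, by simp⟩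

/-- Along such a line the velocity is the constant `w p`, so the lift is affine in time. If a
component were nonzero, at time `π / w p i` the lift would have moved by `π`, which is not zero
modulo `2π`. -/
theorem eq_zero_of_isIntegralLine_singleton {w : Torus → Vec} {p : Torus}
    (h : IsIntegralLine w {p}) : w p = 0 := by
  obtain ⟨X, hX, hrange⟩ := h
  have hp : ∀ s, proj (X s) = p := fun s => by
    have : proj (X s) ∈ ({p} : Set Torus) := hrange ▸ mem_range_self s
    exact this
  simp only [hp] at hX
  ext i
  by_contra hne
  have hd : ∀ s, HasDerivAt (fun s => X s i - s * w p i) 0 s := fun s => by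
    simpa using! (hasDerivAt_pi.1 (hX s) i).sub ((hasDerivAt_id s).mul_const (w p i))
  have hconst := is_const_of_deriv_eq_zero (fun s => (hd s).differentiableAt)
    (fun s => (hd s).deriv) (Real.pi / w p i) 0
  rw [div_mul_cancel₀ _ hne, zero_mul, sub_zero, sub_eq_iff_eq_add] at hconst
  have h1 : ((X (Real.pi / w p i) i : ℝ) : Real.Angle) = (X 0 i : ℝ) :=
    congrFun ((hp _).trans (hp 0).symm) i
  rw [hconst, Real.Angle.coe_add] at h1
  exact Real.Angle.pi_ne_zero (by simpa using h1)

/-- A topological equivalence maps stationary points to stationary points. -/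
theorem TopologicallyEquivalent.encard_zeros_le {v w : Torus → Vec}
    (h : TopologicallyEquivalent v w) :
    {q | v q = 0}.encard ≤ {q | w q = 0}.encard := by
  obtain ⟨φ, hφ⟩ := h
  rw [← φ.injective.encard_image]
  refine encard_le_encard ?_
  rintro _ ⟨p, hp, rfl⟩
  have := hφ {p} (isIntegralLine_singleton hp)
  rw [image_singleton] at this
  exact eq_zero_of_isIntegralLine_singleton this

/-! ### Multiple-angle estimates -/

theorem abs_cos_le_one (θ : Real.Angle) : |Real.Angle.cos θ| ≤ 1 := by
  rw [← sq_le_one_iff_abs_le_one]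
  nlinarith [θ.cos_sq_add_sin_sq, sq_nonneg θ.sin]

theorem abs_sin_le_one (θ : Real.Angle) : |Real.Angle.sin θ| ≤ 1 := by
  rw [← sq_le_one_iff_abs_le_one]
  nlinarith [θ.cos_sq_add_sin_sq, sq_nonneg θ.cos]

theorem abs_sin_nsmul_le (n : ℕ) (θ : Real.Angle) :
    |Real.Angle.sin (n • θ)| ≤ n * |Real.Angle.sin θ| := by
  induction n with
  | zero => simp
  | succ n ih =>
    rw [succ_nsmul, Real.Angle.sin_add]
    calc _ ≤ |Real.Angle.sin (n • θ)| * |Real.Angle.cos θ| +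
          |Real.Angle.cos (n • θ)| * |Real.Angle.sin θ| := by
          rw [← abs_mul, ← abs_mul]; exact abs_add_le _ _
      _ ≤ (n * |Real.Angle.sin θ|) * 1 + 1 * |Real.Angle.sin θ| := by
          gcongr
          · exact abs_cos_le_one θ
          · exact abs_cos_le_one (n • θ)
      _ = _ := by push_cast; ring

/-- Oddness is essential: for even `n` the left side is 1 at `θ = π/2`. The induction advances by 2,
using `|sin 2θ| ≤ 2 |cos θ|`. -/
theorem abs_cos_nsmul_le {n : ℕ} (hn : Odd n) (θ : Real.Angle) :
    |Real.Angle.cos (n • θ)| ≤ n * |Real.Angle.cos θ| := by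
  obtain ⟨k, rfl⟩ := hn
  induction k with
  | zero => simp
  | succ k ih =>
    have hdbl : |Real.Angle.sin (2 • θ)| ≤ 2 * |Real.Angle.cos θ| := by
      rw [two_nsmul, Real.Angle.sin_add, mul_comm θ.cos, ← two_mul, abs_mul, abs_mul, abs_two]
      nlinarith [abs_sin_le_one θ, abs_nonneg θ.cos]
    rw [show 2 * (k + 1) + 1 = (2 * k + 1) + 2 by ring, add_nsmul, Real.Angle.cos_add]
    calc _ ≤ |Real.Angle.cos ((2 * k + 1) • θ)| * |Real.Angle.cos (2 • θ)| +
          |Real.Angle.sin ((2 * k + 1) • θ)| * |Real.Angle.sin (2 • θ)| := by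
          rw [← abs_mul, ← abs_mul]; exact abs_sub _ _
      _ ≤ (((2 * k + 1 : ℕ) : ℝ) * |Real.Angle.cos θ|) * 1 + 1 * (2 * |Real.Angle.cos θ|) := by
          gcongr
          · exact abs_cos_le_one _
          · exact abs_sin_le_one _
      _ = _ := by push_cast; ring

open Classical in
/-- The angles at which the sine or the cosine vanishes. -/
noncomputable def quarterTurns : Finset Real.Angle :=
  {0, (Real.pi : Real.Angle), ((Real.pi / 2 : ℝ) : Real.Angle), ((-Real.pi / 2 : ℝ) : Real.Angle)}

theorem card_quarterTurns_le : quarterTurns.card ≤ 4 := by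
  classical exact Finset.card_le_four

theorem mem_quarterTurns_of_sin_eq_zero {θ : Real.Angle} (h : θ.sin = 0) : θ ∈ quarterTurns := by
  rcases Real.Angle.sin_eq_zero_iff.1 h with h | h <;> simp [quarterTurns, h]

theorem mem_quarterTurns_of_cos_eq_zero {θ : Real.Angle} (h : θ.cos = 0) : θ ∈ quarterTurns := by
  rcases Real.Angle.cos_eq_zero_iff.1 h with h | h <;> simp [quarterTurns, h]

/-! ### Zeros of Taylor fields -/

/-- On the circle `y = π/2` the second component vanishes identically and the first reduces to `sin
nx`, with zeros at the `2n` multiples of `π/n`. -/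
theorem le_encard_zeros_taylor {n : ℕ} (hn : 0 < n) :
    (2 * n : ℕ) ≤ {q | taylor n 1 q = 0}.encard := by
  have hπ := Real.pi_pos
  have hn' : (0 : ℝ) < n := by exact_mod_cast hn
  let f : Fin (2 * n) → Torus := fun i => ![((i * (Real.pi / n) : ℝ) : Real.Angle),
    ((Real.pi / 2 : ℝ) : Real.Angle)]
  have hf : Function.Injective f := fun i j hij => by
    have h0 : ((i * (Real.pi / n) : ℝ) : Real.Angle) = ((j * (Real.pi / n) : ℝ) : Real.Angle) :=
      congrFun hij 0
    have hmem : ∀ k : Fin (2 * n), (k * (Real.pi / n) : ℝ) ∈ Ico (0 : ℝ) (0 + 2 * Real.pi) :=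
      fun k => ⟨by positivity, by
        have : (k : ℝ) < 2 * n := by exact_mod_cast k.2
        rw [zero_add, mul_div_assoc', div_lt_iff₀ hn']
        nlinarith⟩
    have : Fact (0 < 2 * Real.pi) := ⟨Real.two_pi_pos⟩
    have h1 := (AddCircle.coe_eq_coe_iff_of_mem_Ico (hmem i) (hmem j)).1 h0
    have h2 : (i : ℝ) = j := mul_right_cancel₀ (by positivity) h1
    exact Fin.ext (by exact_mod_cast h2)
  calc ((2 * n : ℕ) : ℕ∞) = (range f).encard := by
        rw [← image_univ, hf.encard_image, encard_univ]; simp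
    _ ≤ _ := encard_le_encard ?_
  rintro _ ⟨i, rfl⟩
  have hs : Real.Angle.sin (n • ((i * (Real.pi / n) : ℝ) : Real.Angle)) = 0 := by
    rw [← Real.Angle.natCast_mul_eq_nsmul, Real.Angle.sin_coe,
      show (n : ℝ) * (i * (Real.pi / n)) = (i : ℕ) * Real.pi by field_simp]
    exact Real.sin_nat_mul_pi _
  ext k
  fin_cases k
  · simp [taylor, f, hs, -Real.Angle.natCast_mul_eq_nsmul]
  · simp [taylor, f]

/-- The multiple-angle estimates bound each component of `T_{n1}` by a multiple of that of `T_{11}`,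
so the `T_{11}` part dominates and must vanish at a zero. The second component of `T_{n1}` carries
an extra factor `n`, whence the threshold `a * n ^ 2`. -/
theorem zeros_combination_subset {n : ℕ} (hn : Odd n) {a c : ℝ} (ha : 0 ≤ a)
    (h : a * n ^ 2 < c) :
    {q | (a • taylor n 1 + c • taylor 1 1) q = 0} ⊆
      (Fintype.piFinset fun _ : Fin 2 => quarterTurns : Finset Torus) := by
  have hn1 : (1 : ℝ) ≤ n := by exact_mod_cast hn.pos
  have key : ∀ x y d A : ℝ, 0 ≤ A → A * d < c → |x| ≤ d * |y| → A * x + c * y = 0 → y = 0 := by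
    intro x y d A hA hAd hxy heq
    by_contra hy
    have hy' : 0 < |y| := abs_pos.2 hy
    have h1 : c * |y| ≤ A * |x| := by
      calc c * |y| ≤ |c| * |y| := by gcongr; exact le_abs_self c
        _ = |A * x| := by rw [← abs_mul, ← abs_neg (c * y)]; congr 1; linarith
        _ = A * |x| := by rw [abs_mul, abs_of_nonneg hA]
    nlinarith [mul_le_mul_of_nonneg_left hxy hA]
  intro q hq
  have e0 : a * (Real.Angle.sin (n • q 0) * (q 1).sin) + c * ((q 0).sin * (q 1).sin) = 0 := by
    simpa [taylor] using! congrFun hq 0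
  have e1 : a * n * (Real.Angle.cos (n • q 0) * (q 1).cos) + c * ((q 0).cos * (q 1).cos) = 0 := by
    simpa [taylor, mul_assoc] using! congrFun hq 1
  have z0 := key _ _ n a ha (by nlinarith [mul_nonneg ha (sub_nonneg.2 hn1)]) (by
    rw [abs_mul, abs_mul, ← mul_assoc]; gcongr; exact abs_sin_nsmul_le n _) e0
  have z1 := key _ _ n (a * n) (by positivity) (by nlinarith) (by
    rw [abs_mul, abs_mul, ← mul_assoc]; gcongr; exact abs_cos_nsmul_le hn _) e1
  have hx : ∀ θ : Real.Angle, θ.sin = 0 → θ.cos ≠ 0 := fun θ h1 h2 => by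
    simpa [h1, h2] using θ.cos_sq_add_sin_sq
  simp only [Finset.mem_coe, Fintype.mem_piFinset, Fin.forall_fin_two]
  rcases mul_eq_zero.1 z0 with h0 | h0
  · exact ⟨mem_quarterTurns_of_sin_eq_zero h0,
      mem_quarterTurns_of_cos_eq_zero ((mul_eq_zero.1 z1).resolve_left (hx _ h0))⟩
  · exact ⟨mem_quarterTurns_of_cos_eq_zero ((mul_eq_zero.1 z1).resolve_right (hx _ h0)),
      mem_quarterTurns_of_sin_eq_zero h0⟩

/-- Zero counting: `2n ≥ 18` against at most `4 ^ 2 = 16`. -/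
theorem not_topologicallyEquivalent_taylor {n : ℕ} (hn : Odd n) (h9 : 9 ≤ n) {a c : ℝ}
    (ha : 0 ≤ a) (h : a * n ^ 2 < c) :
    ¬ TopologicallyEquivalent (taylor n 1) (a • taylor n 1 + c • taylor 1 1) := by
  intro he
  have h1 := (le_encard_zeros_taylor hn.pos).trans he.encard_zeros_le
  have h2 := h1.trans (encard_le_encard (zeros_combination_subset hn ha h))
  rw [encard_coe_eq_coe_finsetCard, Nat.cast_le, Fintype.card_piFinset] at h2
  have h3 := card_quarterTurns_le
  simp only [Finset.prod_const, Finset.card_univ, Fintype.card_fin] at h2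
  nlinarith

/-! ### Calculus of Taylor fields -/

theorem smooth_taylor (n m : ℕ) (i : Fin 2) : Smooth (fun q => taylor n m q i) := by
  unfold Smooth
  fin_cases i
  · simp only [taylor, proj, ← Real.Angle.natCast_mul_eq_nsmul, Real.Angle.sin_coe,
      Fin.zero_eta, Matrix.cons_val_zero]
    fun_prop
  · simp only [taylor, proj, ← Real.Angle.natCast_mul_eq_nsmul, Real.Angle.cos_coe,
      Fin.mk_one, Matrix.cons_val_one, Matrix.cons_val_zero]
    fun_prop

theorem hasDerivAt_sin_nsmul (n : ℕ) (θ : Real.Angle) :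
    HasDerivAt (fun s : ℝ => Real.Angle.sin (n • (θ + (s : Real.Angle))))
      (n * Real.Angle.cos (n • θ)) 0 := by
  induction θ using Real.Angle.induction_on with | _ x =>
  simp only [← Real.Angle.coe_add, ← Real.Angle.natCast_mul_eq_nsmul, Real.Angle.sin_coe,
    Real.Angle.cos_coe]
  have h := (((hasDerivAt_id (0 : ℝ)).const_add x).const_mul (n : ℝ)).sin
  simpa [mul_comm] using! h

theorem hasDerivAt_cos_nsmul (n : ℕ) (θ : Real.Angle) :
    HasDerivAt (fun s : ℝ => Real.Angle.cos (n • (θ + (s : Real.Angle))))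
      (-(n * Real.Angle.sin (n • θ))) 0 := by
  induction θ using Real.Angle.induction_on with | _ x =>
  simp only [← Real.Angle.coe_add, ← Real.Angle.natCast_mul_eq_nsmul, Real.Angle.sin_coe,
    Real.Angle.cos_coe]
  have h := (((hasDerivAt_id (0 : ℝ)).const_add x).const_mul (n : ℝ)).cos
  simpa [mul_comm] using! h

theorem pd_zero_mul {f f' : Real.Angle → ℝ}
    (hf : ∀ θ, HasDerivAt (fun s : ℝ => f (θ + (s : Real.Angle))) (f' θ) 0) (c : ℝ)
    (g : Real.Angle → ℝ) :
    pd 0 (fun q => c * (f (q 0) * g (q 1))) = fun q => c * (f' (q 0) * g (q 1)) := by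
  ext q
  simpa [pd] using! (((hf (q 0)).mul_const (g (q 1))).const_mul c).deriv

theorem pd_one_mul {g g' : Real.Angle → ℝ}
    (hg : ∀ θ, HasDerivAt (fun s : ℝ => g (θ + (s : Real.Angle))) (g' θ) 0) (c : ℝ)
    (f : Real.Angle → ℝ) :
    pd 1 (fun q => c * (f (q 0) * g (q 1))) = fun q => c * (f (q 0) * g' (q 1)) := by
  ext q
  simpa [pd] using! (((hg (q 1)).const_mul (f (q 0))).const_mul c).deriv

theorem divergenceFree_taylor (n m : ℕ) : DivergenceFree (taylor n m) := by
  intro q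
  have h0 := congrFun (pd_zero_mul (f := fun θ => Real.Angle.sin (n • θ))
      (hasDerivAt_sin_nsmul n) m fun θ => Real.Angle.sin (m • θ)) q
  have h1 := congrFun (pd_one_mul (g := fun θ => Real.Angle.cos (m • θ))
      (hasDerivAt_cos_nsmul m) n fun θ => Real.Angle.cos (n • θ)) q
  simp only [divergence, taylor, Fin.sum_univ_two, Matrix.cons_val_zero, Matrix.cons_val_one]
  rw [h0, h1]
  ring

theorem laplacian_taylor (n m : ℕ) (i : Fin 2) (q : Torus) :
    laplacian (fun p => taylor n m p i) q = -((n : ℝ) ^ 2 + (m : ℝ) ^ 2) * taylor n m q i := by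
  have hs : ∀ n : ℕ, ∀ θ, HasDerivAt
      (fun s : ℝ => (n : ℝ) * Real.Angle.cos (n • (θ + (s : Real.Angle))))
      (-(n : ℝ) ^ 2 * Real.Angle.sin (n • θ)) 0 := fun n θ => by
    have h := (hasDerivAt_cos_nsmul n θ).const_mul (n : ℝ)
    exact h.congr_deriv (by ring)
  have hc : ∀ n : ℕ, ∀ θ, HasDerivAt
      (fun s : ℝ => -((n : ℝ) * Real.Angle.sin (n • (θ + (s : Real.Angle)))))
      (-(n : ℝ) ^ 2 * Real.Angle.cos (n • θ)) 0 := fun n θ => by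
    have h := ((hasDerivAt_sin_nsmul n θ).const_mul (n : ℝ)).neg
    exact h.congr_deriv (by ring)
  fin_cases i
  · have h0 := pd_zero_mul (f := fun θ => Real.Angle.sin (n • θ))
      (hasDerivAt_sin_nsmul n) m fun θ => Real.Angle.sin (m • θ)
    have h1 := pd_one_mul (g := fun θ => Real.Angle.sin (m • θ))
      (hasDerivAt_sin_nsmul m) m fun θ => Real.Angle.sin (n • θ)
    have h00 := pd_zero_mul (f := fun θ => (n : ℝ) * Real.Angle.cos (n • θ)) (hs n) m
      fun θ => Real.Angle.sin (m • θ)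
    have h11 := pd_one_mul (g := fun θ => (m : ℝ) * Real.Angle.cos (m • θ)) (hs m) m
      fun θ => Real.Angle.sin (n • θ)
    simp only [laplacian, taylor, Fin.sum_univ_two, Fin.zero_eta, Matrix.cons_val_zero]
    rw [h0, h1, h00, h11]
    ring
  · have h0 := pd_zero_mul (f := fun θ => Real.Angle.cos (n • θ))
      (hasDerivAt_cos_nsmul n) n fun θ => Real.Angle.cos (m • θ)
    have h1 := pd_one_mul (g := fun θ => Real.Angle.cos (m • θ))
      (hasDerivAt_cos_nsmul m) n fun θ => Real.Angle.cos (n • θ)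
    have h00 := pd_zero_mul (f := fun θ => -((n : ℝ) * Real.Angle.sin (n • θ))) (hc n) n
      fun θ => Real.Angle.cos (m • θ)
    have h11 := pd_one_mul (g := fun θ => -((m : ℝ) * Real.Angle.sin (m • θ))) (hc m) n
      fun θ => Real.Angle.cos (n • θ)
    simp only [laplacian, taylor, Fin.sum_univ_two, Fin.mk_one, Matrix.cons_val_one,
      Matrix.cons_val_zero]
    rw [h0, h1, h00, h11]
    ring

theorem exists_abs_pd_taylor_le (n m : ℕ) :
    ∃ C, 0 ≤ C ∧ ∀ q i j, |pd j (fun p => taylor n m p i) q| ≤ C := by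
  choose C hC using fun i j => ((smooth_taylor n m i).pd j).exists_abs_le
  have h0 : ∀ i j, 0 ≤ C i j := fun i j => (abs_nonneg _).trans (hC i j 0)
  refine ⟨∑ i, ∑ j, C i j, Finset.sum_nonneg fun i _ => Finset.sum_nonneg fun j _ => h0 i j,
    fun q i j => (hC i j q).trans ?_⟩
  exact (Finset.single_le_sum (fun j _ => h0 i j) (Finset.mem_univ j)).trans
    (Finset.single_le_sum (f := fun i => ∑ j, C i j)
      (fun i _ => Finset.sum_nonneg fun j _ => h0 i j) (Finset.mem_univ i))

/-! ### Combinations of two Taylor fields -/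

section Combination

variable (a c : ℝ) (n m k l : ℕ)

theorem smooth_combination (i : Fin 2) :
    Smooth (fun q => (a • taylor n m + c • taylor k l) q i) :=
  ((smooth_taylor n m i).const_mul a).add ((smooth_taylor k l i).const_mul c)

theorem pd_combination (i j : Fin 2) (q : Torus) :
    pd j (fun p => (a • taylor n m + c • taylor k l) p i) q =
      a * pd j (fun p => taylor n m p i) q + c * pd j (fun p => taylor k l p i) q := by
  rw [← pd_const_mul, ← pd_const_mul]
  exact ((smooth_taylor n m i).const_mul a).pd_add ((smooth_taylor k l i).const_mul c) j q

theorem divergenceFree_combination : DivergenceFree (a • taylor n m + c • taylor k l) := by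
  intro q
  have h1 := divergenceFree_taylor n m q
  have h2 := divergenceFree_taylor k l q
  simp only [divergence, pd_combination, Finset.sum_add_distrib, ← Finset.mul_sum] at *
  rw [h1, h2]
  ring

theorem pd_pd_combination (i j : Fin 2) (q : Torus) :
    pd j (pd j (fun p => (a • taylor n m + c • taylor k l) p i)) q =
      a * pd j (pd j (fun p => taylor n m p i)) q +
        c * pd j (pd j (fun p => taylor k l p i)) q := by
  rw [funext (pd_combination a c n m k l i j), ← pd_const_mul, ← pd_const_mul]
  exact (((smooth_taylor n m i).pd j).const_mul a).pd_add
    (((smooth_taylor k l i).pd j).const_mul c) j q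

theorem laplacian_combination (i : Fin 2) (q : Torus) :
    laplacian (fun p => (a • taylor n m + c • taylor k l) p i) q =
      -((n : ℝ) ^ 2 + (m : ℝ) ^ 2) * (a * taylor n m q i) +
        -((k : ℝ) ^ 2 + (l : ℝ) ^ 2) * (c * taylor k l q i) := by
  have h1 := laplacian_taylor n m i q
  have h2 := laplacian_taylor k l i q
  simp only [laplacian, pd_pd_combination, Finset.sum_add_distrib, ← Finset.mul_sum] at *
  rw [h1, h2]
  ring

variable {n m k l}

/-- Dividing each coefficient by minus its eigenvalue exhibits the combination as a Laplacian, hence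
as the divergence of a gradient. -/
theorem zeroAverage_combination (hn : 0 < n) (hk : 0 < k) :
    ZeroAverage (a • taylor n m + c • taylor k l) := by
  have hn' : ((n : ℝ) ^ 2 + (m : ℝ) ^ 2) ≠ 0 := by positivity
  have hk' : ((k : ℝ) ^ 2 + (l : ℝ) ^ 2) ≠ 0 := by positivity
  refine zeroAverage_of_eq_divergence (F := fun i j => pd j (fun p =>
    ((-(a / ((n : ℝ) ^ 2 + (m : ℝ) ^ 2))) • taylor n m +
      (-(c / ((k : ℝ) ^ 2 + (l : ℝ) ^ 2))) • taylor k l) p i))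
    (fun i j => (smooth_combination ..).pd j) fun q i => ?_
  refine Eq.trans ?_ (laplacian_combination _ _ n m k l i q).symm
  simp only [Pi.add_apply, Pi.smul_apply, smul_eq_mul]
  field_simp

end Combination

/-- The average of `(v · ∇) v` vanishes if `v` is divergence-free. -/
theorem zeroAverage_neg_advect_self {v : Torus → Vec} (hv : ∀ i, Smooth (fun q => v q i))
    (hdiv : DivergenceFree v) : ZeroAverage (fun q i => -advect v v q i) := by
  -- For divergence-free `v`, `(v·∇)v = div (v ⊗ v)`.
  refine zeroAverage_of_eq_divergence (F := fun i j q => -1 * (v q j * v q i))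
    (fun i j => ((hv j).mul (hv i)).const_mul _) fun q i => ?_
  have h := hdiv q
  simp only [divergence, Fin.sum_univ_two] at h
  simp only [pd_const_mul, (hv _).pd_mul (hv _), advect, Fin.sum_univ_two]
  linear_combination v q i * h

/-! ### The explicit solution -/

/-- The magnetic field diffusing from `T_{nm}` under the steady forcing `T_{kl}`. -/
noncomputable def reconnectingField (η : ℝ) (n m k l : ℕ) (t : ℝ) : Torus → Vec :=
  Real.exp (-(η * ((n : ℝ) ^ 2 + (m : ℝ) ^ 2) * t)) • taylor n m +
    ((1 - Real.exp (-(η * ((k : ℝ) ^ 2 + (l : ℝ) ^ 2) * t))) /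
      (η * ((k : ℝ) ^ 2 + (l : ℝ) ^ 2))) • taylor k l

section ReconnectingField

variable (η : ℝ) (n m k l : ℕ)

theorem reconnectingField_zero : reconnectingField η n m k l 0 = taylor n m := by
  simp [reconnectingField]

theorem smoothOver_reconnectingField (I : Set ℝ) : SmoothOver I (reconnectingField η n m k l) := by
  refine SmoothOver.pi fun i => ContDiff.contDiffOn ?_
  have hT : ∀ n m : ℕ, ContDiff ℝ ∞ (fun p : ℝ × Vec => taylor n m (proj p.2) i) := fun n m =>
    ContDiff.comp (g := fun x : Vec => taylor n m (proj x) i) (smooth_taylor n m i) contDiff_snd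
  simp only [reconnectingField, Pi.add_apply, Pi.smul_apply, smul_eq_mul]
  refine ContDiff.add (ContDiff.mul (by fun_prop) (hT n m)) (ContDiff.mul ?_ (hT k l))
  exact ContDiff.div_const (by fun_prop) _

/-- Both time coefficients are bounded for `t ≥ 0`, by `1` and by the inverse of `η (k² + l²)`;
uniqueness needs a bound uniform in time. -/
theorem exists_abs_pd_reconnectingField_le {η : ℝ} (hη : 0 < η) {k : ℕ} (hk : 0 < k) :
    ∃ M, 0 ≤ M ∧ ∀ t, 0 ≤ t → ∀ q i j,
      |pd j (fun p => reconnectingField η n m k l t p i) q| ≤ M := by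
  obtain ⟨C, hC0, hC⟩ := exists_abs_pd_taylor_le n m
  obtain ⟨D, hD0, hD⟩ := exists_abs_pd_taylor_le k l
  have hlam : 0 < η * ((k : ℝ) ^ 2 + (l : ℝ) ^ 2) := by positivity
  refine ⟨1 * C + 1 / (η * ((k : ℝ) ^ 2 + (l : ℝ) ^ 2)) * D, by positivity,
    fun t ht q i j => ?_⟩
  simp only [reconnectingField, pd_combination]
  have hexp : Real.exp (-(η * ((k : ℝ) ^ 2 + (l : ℝ) ^ 2) * t)) ≤ 1 :=
    Real.exp_le_one_iff.2 (by simpa using mul_nonneg hlam.le ht)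
  refine (abs_add_le _ _).trans ?_
  rw [abs_mul, abs_mul, Real.abs_exp, abs_div, abs_of_pos hlam, abs_of_nonneg (sub_nonneg.2 hexp)]
  gcongr
  · exact Real.exp_le_one_iff.2 (by rw [neg_nonpos]; positivity)
  · exact hC q i j
  · linarith [Real.exp_pos (-(η * ((k : ℝ) ^ 2 + (l : ℝ) ^ 2) * t))]
  · exact hD q i j

theorem hasDerivAt_reconnectingField {η : ℝ} (hη : 0 < η) {k : ℕ} (hk : 0 < k) (t : ℝ)
    (q : Torus) (i : Fin 2) :
    HasDerivAt (fun s => reconnectingField η n m k l s q i)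
      (η * laplacian (fun p => reconnectingField η n m k l t p i) q + taylor k l q i) t := by
  have hlam : η * ((k : ℝ) ^ 2 + (l : ℝ) ^ 2) ≠ 0 := by positivity
  have he : ∀ μ : ℝ, HasDerivAt (fun s => Real.exp (-(μ * s))) (Real.exp (-(μ * t)) * -μ) t :=
    fun μ => by simpa using! (((hasDerivAt_id t).const_mul μ).neg).exp
  have h := ((he (η * ((n : ℝ) ^ 2 + (m : ℝ) ^ 2))).mul_const (taylor n m q i)).add
    ((((he (η * ((k : ℝ) ^ 2 + (l : ℝ) ^ 2))).const_sub 1).div_const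
      (η * ((k : ℝ) ^ 2 + (l : ℝ) ^ 2))).mul_const (taylor k l q i))
  refine HasDerivAt.congr_deriv (f := fun s => reconnectingField η n m k l s q i) h ?_
  simp only [reconnectingField, laplacian_combination]
  field_simp
  ring

/-- At rest, `reconnectingField` solves the forced MHD system. -/
theorem isGlobalSmoothSolution_reconnectingField (ν : ℝ) {η : ℝ} (hη : 0 < η) {k : ℕ}
    (hk : 0 < k) :
    IsGlobalSmoothSolution ν η
      (fun t q i => -advect (reconnectingField η n m k l t) (reconnectingField η n m k l t) q i)
      (fun _ => taylor k l) 0 (taylor n m) 0 (reconnectingField η n m k l) where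
  smooth_u := contDiffOn_const
  smooth_b := smoothOver_reconnectingField η n m k l _
  div_u t _ q := by simp [divergence, pd]
  div_b t _ := divergenceFree_combination _ _ _ _ _ _
  momentum := by
    refine ⟨fun _ _ => 0, contDiffOn_const, fun t _ q i => ?_⟩
    simp [advect, laplacian, pd]
  magnetic t ht q i := by
    rw [(hasDerivAt_reconnectingField n m l hη hk t q i).hasDerivWithinAt.derivWithin
      (uniqueDiffOn_Ici 0 t ht)]
    simp [advect, pd]
  initial_u := rfl
  initial_b := reconnectingField_zero η n m k l

end ReconnectingField

/-- The quadratic lower bound for `exp` gives `exp (r (n² + 1)) ≥ r² n⁴ / 2`, which exceeds `n² / c`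
once `n r² c > 2` and `n ≥ 1`. The choice `2N + 9` secures parity and size. -/
theorem exists_odd_exp_mul_sq_lt {r c : ℝ} (hr : 0 < r) (hc : 0 < c) (B : ℝ) :
    ∃ n : ℕ, Odd n ∧ 9 ≤ n ∧ B < n ∧ Real.exp (-(r * ((n : ℝ) ^ 2 + 1))) * n ^ 2 < c := by
  obtain ⟨N, hN⟩ := exists_nat_gt (max B (2 / (r ^ 2 * c)))
  have hn : (N : ℝ) < ((2 * N + 9 : ℕ) : ℝ) := by push_cast; linarith [N.cast_nonneg (α := ℝ)]
  refine ⟨2 * N + 9, ⟨N + 4, by ring⟩, by omega,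
    (le_max_left _ _).trans_lt (hN.trans hn), ?_⟩
  set n : ℝ := ((2 * N + 9 : ℕ) : ℝ)
  have hn1 : 1 ≤ n := by simp only [n]; exact_mod_cast (by omega : 1 ≤ 2 * N + 9)
  have hlarge : 2 < n * (r ^ 2 * c) :=
    (div_lt_iff₀ (by positivity)).1 (((le_max_right _ _).trans_lt hN).trans hn)
  have hx : 0 ≤ r * (n ^ 2 + 1) := by positivity
  have hexp := Real.quadratic_le_exp_of_nonneg hx
  rw [Real.exp_neg, inv_mul_eq_div, div_lt_iff₀ (Real.exp_pos _)]
  have h1 : n ^ 2 * 2 < n ^ 2 * (n ^ 2 * (r ^ 2 * c)) := by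
    gcongr
    refine hlarge.trans_le ?_
    gcongr
    nlinarith
  calc n ^ 2 < c * ((r * (n ^ 2 + 1)) ^ 2 / 2) := by
        nlinarith [mul_pos (pow_pos hr 2) hc, sq_nonneg n,
          mul_nonneg (mul_pos (pow_pos hr 2) hc).le (sq_nonneg n)]
    _ ≤ c * Real.exp (r * (n ^ 2 + 1)) := by
        gcongr
        linarith

end MHD

/-- For all `ν, η, T > 0` there are a smooth datum `b₀` and smooth forces `f₁, f₂` on
`[0, ∞) × 𝕋²` for which forced MHD with datum `(0, b₀)` has a unique global smooth solution; its
magnetic lines at times `0` and `T` are not topologically equivalent. The velocity vanishes and the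
magnetic field is an explicit combination of two Taylor fields, whose eigenvalues can be taken
with ratio larger than any prescribed `K`. -/
theorem theorem1p2 (ν η T : ℝ) (hν : 0 < ν) (hη : 0 < η) (hT : 0 < T) (K : ℝ) :
    ∃ (b₀ : MHD.Torus → MHD.Vec) (f₁ f₂ u b : ℝ → MHD.Torus → MHD.Vec),
      MHD.SmoothField b₀ ∧ MHD.ZeroAverage b₀ ∧ MHD.DivergenceFree b₀ ∧
      MHD.SmoothInTime f₁ ∧ (∀ t, 0 ≤ t → MHD.ZeroAverage (f₁ t)) ∧
      MHD.SmoothInTime f₂ ∧ (∀ t, 0 ≤ t → MHD.ZeroAverage (f₂ t)) ∧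
      MHD.IsGlobalSmoothSolution ν η f₁ f₂ 0 b₀ u b ∧
      (∀ t, 0 ≤ t → MHD.ZeroAverage (u t) ∧ MHD.ZeroAverage (b t)) ∧
      (∀ u' b' : ℝ → MHD.Torus → MHD.Vec,
        MHD.IsGlobalSmoothSolution ν η f₁ f₂ 0 b₀ u' b' →
          ∀ t, 0 ≤ t → u' t = u t ∧ b' t = b t) ∧
      ¬ MHD.TopologicallyEquivalent (b 0) (b T) ∧
      (∃ n m k l : ℕ, 0 < n ∧ 0 < m ∧ 0 < k ∧ 0 < l ∧
        K * ((k : ℝ) ^ 2 + (l : ℝ) ^ 2) < (n : ℝ) ^ 2 + (m : ℝ) ^ 2 ∧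
        ∀ t, 0 ≤ t → u t = 0 ∧
          b t = Real.exp (-(η * ((n : ℝ) ^ 2 + (m : ℝ) ^ 2) * t)) • MHD.taylor n m +
            ((1 - Real.exp (-(η * ((k : ℝ) ^ 2 + (l : ℝ) ^ 2) * t))) /
              (η * ((k : ℝ) ^ 2 + (l : ℝ) ^ 2))) • MHD.taylor k l) := by
  have hc : 0 < (1 - Real.exp (-(η * (((1 : ℕ) : ℝ) ^ 2 + ((1 : ℕ) : ℝ) ^ 2) * T))) /
      (η * (((1 : ℕ) : ℝ) ^ 2 + ((1 : ℕ) : ℝ) ^ 2)) := by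
    refine div_pos (sub_pos.2 (Real.exp_lt_one_iff.2 ?_)) (by positivity)
    rw [neg_lt_zero]
    positivity
  -- Here `r = η T` and `c` is the coefficient of `T_{11}` at time `T`. With `k = l = 1` the
  -- eigenvalue condition reads `2K < n² + 1`, so `n > 2K` is enough.
  obtain ⟨n, hodd, h9, hKn, hlt⟩ := MHD.exists_odd_exp_mul_sq_lt (mul_pos hη hT) hc (2 * K)
  have hsmooth : ∀ t i, MHD.Smooth (fun q => MHD.reconnectingField η n 1 1 1 t q i) :=
    fun t i => MHD.smooth_combination ..
  have hzero : MHD.ZeroAverage 0 := fun i => by simp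
  have hT1 : ∀ m, 0 < m → MHD.ZeroAverage (MHD.taylor m 1) := fun m hm => by
    simpa using MHD.zeroAverage_combination (m := 1) (l := 1) 1 0 hm hm
  have hsol := MHD.isGlobalSmoothSolution_reconnectingField n 1 1 ν hη one_pos
  refine ⟨MHD.taylor n 1, _, _, 0, MHD.reconnectingField η n 1 1 1,
    contDiff_pi.2 (MHD.smooth_taylor n 1), hT1 n hodd.pos, MHD.divergenceFree_taylor n 1,
    ?_, fun t _ => MHD.zeroAverage_neg_advect_self (hsmooth t) (MHD.divergenceFree_combination _ _ _ _ _ _),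
    ?_, fun t _ => hT1 1 one_pos, hsol, fun t _ => ⟨hzero, ?_⟩, ?_, ?_,
    n, 1, 1, 1, hodd.pos, one_pos, one_pos, one_pos, ?_, fun t _ => ⟨rfl, rfl⟩⟩
  -- The explicit field is smooth for all real times, so the spatial derivative can be taken over
  -- the open set `univ` and the result restricted to `[0, ∞)`.
  · have hs := MHD.smoothOver_reconnectingField η n 1 1 1 Set.univ
    exact MHD.SmoothOver.mono (J := Set.univ) (MHD.SmoothOver.pi fun i =>
      (MHD.SmoothOver.sum fun j _ => (hs.apply j).mul ((hs.apply i).pd isOpen_univ j)).neg)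
      (Set.subset_univ _)
  · exact ((contDiff_pi.2 (MHD.smooth_taylor 1 1)).comp contDiff_snd).contDiffOn
  · exact MHD.zeroAverage_combination _ _ hodd.pos one_pos
  · intro u' b' h' t ht
    obtain ⟨M, hM0, hM⟩ := MHD.exists_abs_pd_reconnectingField_le n 1 1 hη one_pos
    exact hsol.unique hν.le hη.le h' (fun t _ q i j => by simpa [MHD.pd] using hM0) hM ht
  · rw [MHD.reconnectingField_zero]
    refine MHD.not_topologicallyEquivalent_taylor hodd h9 (Real.exp_pos _).le ?_
    refine (Eq.le ?_).trans_lt hlt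
    push_cast
    ring_nf
  · have : (9 : ℝ) ≤ n := by exact_mod_cast h9
    push_cast
    nlinarith
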